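/- Let $k$ be an algebraically closed field of characteristic not equal to $2$, and let $D(\Lambda_2)$ be the Drinfel'd double of the Taft algebra for $n=2$, i.e. the $k$-algebra generated by $x, X, g, G$ subject to the relations $$x^2=0,\quad X^2=0,\quad g^2=1,\quad G^2=1,\quad gG=Gg,\quad gx=-xg,\quad gX=-Xg,\quad Gx=-xG,\quad GX=-XG,\quad xX+Xx=1-gG.$$ Let $k$ also denote the trivial left $D(\Lambda_2)$-module (one-dimensional, $g$ and $G$ act as $1$, $x$ and $X$ act as $0$), and let $k_-$ be the one-dimensional left $D(\Lambda_2)$-module on which $g$ and $G$ act as $-1$ and $x$ and $X$ act as $0$. For $D(\Lambda_2)$-modules $M,N$ put $\operatorname{Ext}^*(M,N)=\bigoplus_{n\ge 0}\operatorname{Ext}^n_{D(\Lambda_2)}(M,N)$, regarded through the Yoneda product as a left module over the ring $\operatorname{Ext}^*(N,N)$ and as a right module over the ring $\operatorname{Ext}^*(M,M)$. Then: 1. $\operatorname{Ext}^*(k,k_-)$ is generated by $\operatorname{Ext}^1(k,k_-)$ as a left $\operatorname{Ext}^*(k_-,k_-)$-module, and it is also generated by $\operatorname{Ext}^1(k,k_-)$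 as a right $\operatorname{Ext}^*(k,k)$-module. 2. $\operatorname{Ext}^*(k_-,k)$ is generated by $\operatorname{Ext}^1(k_-,k)$ as a left $\operatorname{Ext}^*(k,k)$-module, and it is also generated by $\operatorname{Ext}^1(k_-,k)$ as a right $\operatorname{Ext}^*(k_-,k_-)$-module. -/

import Mathlib

open CategoryTheory CategoryTheory.Abelian
open scoped DirectSum

universe w v u

/-! ### The graded group `Ext*(X, Y)` with the Yoneda product -/

section YonedaExt

variable {C : Type u} [Category.{v} C] [Abelian C] [HasExt.{w} C]

/-- `Ext*(X, Y) = ⨁ₙ Extⁿ(X, Y)` in an abelian category. -/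
def ExtStar (X Y : C) : Type w := ⨁ n : ℕ, Ext.{w} X Y n

namespace ExtStar

noncomputable instance (X Y : C) : AddCommGroup (ExtStar X Y) :=
  inferInstanceAs (AddCommGroup (⨁ n : ℕ, Ext.{w} X Y n))

/-- The inclusion of the homogeneous component `Extⁿ(X, Y)` into `Ext*(X, Y)`. -/
noncomputable def of (X Y : C) (n : ℕ) : Ext.{w} X Y n →+ ExtStar X Y :=
  DirectSum.of (fun n : ℕ => Ext.{w} X Y n) n

/-- The additive map out of `Ext*(X, Y)` with given homogeneous components. -/
noncomputable def lift {X Y : C} {M : Type*} [AddCommMonoid M] (f : ∀ n, Ext.{w} X Y n →+ M) :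
    ExtStar X Y →+ M :=
  DirectSum.toAddMonoid f

@[simp]
lemma lift_of {X Y : C} {M : Type*} [AddCommMonoid M] (f : ∀ n, Ext.{w} X Y n →+ M) (n : ℕ)
    (α : Ext.{w} X Y n) : lift f (of X Y n α) = f n α :=
  DirectSum.toAddMonoid_of f n α

/-- The Yoneda product `Ext*(Y, Z) × Ext*(X, Y) → Ext*(X, Z)`, `(α, β) ↦ α ∘ β`; it is biadditive
and on homogeneous elements it is the composition of extension classes
(which `Ext.comp` writes in the opposite order). -/
noncomputable def yoneda (X Y Z : C) : ExtStar Y Z →+ ExtStar X Y →+ ExtStar X Z :=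
  lift fun a => AddMonoidHom.flip <| lift fun b =>
    AddMonoidHom.mk' (fun β => AddMonoidHom.mk'
      (fun α => of X Z (a + b) (Ext.comp β α (add_comm b a)))
      (fun α₁ α₂ => by rw [Ext.comp_add, map_add]))
      (fun β₁ β₂ => by ext α; simp [Ext.add_comp])

lemma yoneda_of_of {X Y Z : C} {a b : ℕ} (α : Ext.{w} Y Z a) (β : Ext.{w} X Y b) :
    yoneda X Y Z (of Y Z a α) (of X Y b β) = of X Z (a + b) (β.comp α (add_comm b a)) := by
  simp [yoneda]

@[elab_as_elim]
lemma induction {X Y : C} {p : ExtStar X Y → Prop} (x : ExtStar X Y) (zero : p 0)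
    (of : ∀ n (α : Ext.{w} X Y n), p (of X Y n α)) (add : ∀ x y, p x → p y → p (x + y)) : p x :=
  DirectSum.induction_on x zero of add

lemma of_comp_congr {X Y Z : C} {a b c c' : ℕ} (α : Ext.{w} X Y a) (β : Ext.{w} Y Z b)
    (h : a + b = c) (h' : a + b = c') : of X Z c (α.comp β h) = of X Z c' (α.comp β h') := by
  subst h
  subst h'
  rfl

lemma yoneda_assoc {X Y Z T : C} (α : ExtStar Z T) (β : ExtStar Y Z) (γ : ExtStar X Y) :
    yoneda X Y T (yoneda Y Z T α β) γ = yoneda X Z T α (yoneda X Y Z β γ) := by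
  induction α using induction with
  | zero => simp
  | add x y hx hy => simp [hx, hy]
  | of a α =>
    induction β using induction with
    | zero => simp
    | add x y hx hy => simp [hx, hy]
    | of b β =>
      induction γ using induction with
      | zero => simp
      | add x y hx hy => simp [hx, hy]
      | of c γ =>
        simp only [yoneda_of_of]
        rw [← Ext.comp_assoc γ β α (add_comm c b) (add_comm b a) (by omega)]
        exact of_comp_congr _ _ _ _

/-- The identity class in `Ext⁰(X, X)`. -/
noncomputable def one (X : C) : ExtStar X X := of X X 0 (Ext.mk₀ (𝟙 X))

lemma one_yoneda {X Y : C} (β : ExtStar X Y) : yoneda X Y Y (one Y) β = β := by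
  induction β using induction with
  | zero => simp
  | add x y hx hy => simp [hx, hy]
  | of b β =>
    rw [one, yoneda_of_of, of_comp_congr _ _ _ (add_zero b), Ext.comp_mk₀_id]

lemma yoneda_one {X Y : C} (α : ExtStar X Y) : yoneda X X Y α (one X) = α := by
  induction α using induction with
  | zero => simp
  | add x y hx hy => simp [hx, hy]
  | of a α =>
    rw [one, yoneda_of_of, of_comp_congr _ _ _ (zero_add a), Ext.mk₀_id_comp]

/-- The Yoneda algebra `Ext*(X, X)`. -/
noncomputable instance (X : C) : Ring (ExtStar X X) :=
  { (inferInstance : AddCommGroup (ExtStar X X)) with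
    mul := fun α β => yoneda X X X α β
    one := one X
    mul_assoc := yoneda_assoc
    one_mul := one_yoneda
    mul_one := yoneda_one
    left_distrib := fun α β γ => map_add (yoneda X X X α) β γ
    right_distrib := fun α β γ => by
      change yoneda X X X (α + β) γ = yoneda X X X α γ + yoneda X X X β γ
      simp
    zero_mul := fun α => by
      change yoneda X X X 0 α = 0
      simp
    mul_zero := fun α => map_zero (yoneda X X X α) }

/-- `Ext*(X, Y)` is a left `Ext*(Y, Y)`-module: `α • β = α ∘ β`. -/
noncomputable instance leftModule (X Y : C) : Module (ExtStar Y Y) (ExtStar X Y) where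
  smul α β := yoneda X Y Y α β
  one_smul := one_yoneda
  mul_smul := yoneda_assoc
  smul_zero α := map_zero (yoneda X Y Y α)
  smul_add α := map_add (yoneda X Y Y α)
  add_smul α α' β := by
    change yoneda X Y Y (α + α') β = yoneda X Y Y α β + yoneda X Y Y α' β
    simp
  zero_smul β := by
    change yoneda X Y Y 0 β = 0
    simp

/-- `Ext*(X, Y)` is a right `Ext*(X, X)`-module, that is, a left module over the opposite ring:
`op γ • β = β ∘ γ`. -/
noncomputable instance rightModule (X Y : C) : Module (ExtStar X X)ᵐᵒᵖ (ExtStar X Y) where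
  smul γ β := yoneda X X Y β γ.unop
  one_smul := yoneda_one
  mul_smul γ γ' β := (yoneda_assoc β γ'.unop γ.unop).symm
  smul_zero γ := by
    change yoneda X X Y 0 γ.unop = 0
    simp
  smul_add γ β β' := by
    change yoneda X X Y (β + β') γ.unop = yoneda X X Y β γ.unop + yoneda X X Y β' γ.unop
    simp
  add_smul γ γ' β := map_add (yoneda X X Y β) γ.unop γ'.unop
  zero_smul β := map_zero (yoneda X X Y β)

end ExtStar

end YonedaExt

/-! ### The Drinfel'd double of the Taft algebra for `n = 2` -/

namespace TaftDouble

/-- The four generators. -/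
inductive Gen : Type
  | x | X | g | G

section

variable (k : Type u) [Field k]

/-- The free algebra `k⟨x, X, g, G⟩`. -/
abbrev Free : Type u := FreeAlgebra k Gen

/-- A generator as an element of the free algebra. -/
abbrev gen (s : Gen) : Free k := FreeAlgebra.ι k s

/-- The defining relations. -/
inductive Rel : Free k → Free k → Prop
  | x_sq : Rel (gen k .x * gen k .x) 0
  | X_sq : Rel (gen k .X * gen k .X) 0
  | g_sq : Rel (gen k .g * gen k .g) 1
  | G_sq : Rel (gen k .G * gen k .G) 1
  | gG : Rel (gen k .g * gen k .G) (gen k .G * gen k .g)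
  | gx : Rel (gen k .g * gen k .x) (-(gen k .x * gen k .g))
  | gX : Rel (gen k .g * gen k .X) (-(gen k .X * gen k .g))
  | Gx : Rel (gen k .G * gen k .x) (-(gen k .x * gen k .G))
  | GX : Rel (gen k .G * gen k .X) (-(gen k .X * gen k .G))
  | xX : Rel (gen k .x * gen k .X + gen k .X * gen k .x) (1 - gen k .g * gen k .G)

end

end TaftDouble

/-- The algebra `D(Λ₂)` given by generators and relations. -/
abbrev TaftDouble (k : Type u) [Field k] : Type u := RingQuot (TaftDouble.Rel k)

namespace TaftDouble

section

variable (k : Type u) [Field k]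

/-- For `ε² = 1`, the algebra homomorphism `D(Λ₂) → k` with `x, X ↦ 0` and `g, G ↦ ε`. -/
def character (ε : k) (hε : ε * ε = 1) : TaftDouble k →ₐ[k] k :=
  RingQuot.liftAlgHom k ⟨FreeAlgebra.lift k fun
    | .x => 0
    | .X => 0
    | .g => ε
    | .G => ε, by
      intro a b h
      cases h <;> simp [hε]⟩

/-- The counit of `D(Λ₂)`: `x, X ↦ 0` and `g, G ↦ 1`. -/
def counit : TaftDouble k →ₐ[k] k := character k 1 (by simp)

/-- The trivial `D(Λ₂)`-module: `k`, with `D(Λ₂)` acting through the counit. -/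
noncomputable def triv : ModuleCat.{u} (TaftDouble k) :=
  (ModuleCat.restrictScalars (counit k).toRingHom).obj (ModuleCat.of k k)

/-- The one-dimensional `D(Λ₂)`-module `k₋`: `k`, with `g, G` acting as `-1` and `x, X` as `0`. -/
noncomputable def kMinus : ModuleCat.{u} (TaftDouble k) :=
  (ModuleCat.restrictScalars (character k (-1) (by simp)).toRingHom).obj (ModuleCat.of k k)

end

end TaftDouble

/-! Write `S ε` for the one-dimensional module on which `g` and `G` act as `ε = ±1`. There are two
basic extensions of `S ε` by `S (-ε)`: in `U`, `x` carries the top vector to the bottom one; in `V`,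
`X` does. The point is that every class of positive degree out of `S ε` has the form `β[U] + γ[V]`.

The projective cover `P` of `S ε`, with basis `v, xv, Xv, xXv`, is an extension of `U ε` by `U
(-ε)`, and it maps onto `V ε`. Hence the class of `P`, pushed out along `U (-ε) ⟶ S (-ε)`, is `[V]`
pulled back to `U ε`. Since `P` is projective, dimension shifting shows by induction that pullback
`Extⁿ(S ε, T) → Extⁿ(U ε, T)` is onto for simple `T`, and that for `n > 0` multiples of `[V]`
already suffice (`πU_precomp_surjective`). So a class `α` of positive degree agrees on `U ε` with
some `γ[V]`, and by the long exact sequence of `U` the difference is a multiple of `[U]`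
(`KoszulFamily.factorsThroughExtOne`).

Left generation follows, because `Ext⁰` between the two distinct simples is zero. For right
generation two degree-one factors are split off at a time; their product lies in the Yoneda algebra
of the source. -/

section Generation

variable {C : Type u} [Category.{v} C] [Abelian C] [HasExt.{w} C]

/-- Every class of positive degree in `Ext*(M, T)` is a sum of two products with classes in
`Ext¹(M, N)`. -/
def FactorsThroughExtOne (M N T : C) : Prop :=
  ∀ (n : ℕ) (α : Ext.{w} M T (n + 1)), ∃ (a b : Ext.{w} M N 1) (β γ : Ext.{w} N T n),
    α = a.comp β (add_comm 1 n) + b.comp γ (add_comm 1 n)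

/-! ### Generation in degree one from factorization through `Ext¹`. -/

namespace ExtStar

/-- `K` is only an additive subgroup, so that the lemma applies both to submodules over either ring
and to their preimages under a Yoneda product. -/
lemma of_mem_of_factors {M N T : C} (h : FactorsThroughExtOne.{w} M N T)
    (K : AddSubgroup (ExtStar M T)) (n : ℕ)
    (hK : ∀ (a : Ext.{w} M N 1) (β : Ext.{w} N T n),
      yoneda M N T (of N T n β) (of M N 1 a) ∈ K) (α : Ext.{w} M T (n + 1)) :
    of M T (n + 1) α ∈ K := by
  obtain ⟨a, b, β, γ, rfl⟩ := h n α
  rw [map_add, ← yoneda_of_of, ← yoneda_of_of]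
  exact K.add_mem (hK a β) (hK b γ)

lemma of_zero_eq_zero {M N : C} (h : ∀ f : M ⟶ N, f = 0) (α : Ext.{w} M N 0) :
    of M N 0 α = 0 := by
  obtain ⟨f, rfl⟩ := (Ext.mk₀_bijective M N).2 α
  rw [h f, Ext.mk₀_zero, map_zero]

theorem span_left_eq_top {M N : C} (h₀ : ∀ f : M ⟶ N, f = 0)
    (h : FactorsThroughExtOne.{w} M N N) :
    Submodule.span (ExtStar N N) (Set.range (of M N 1)) = ⊤ := by
  refine eq_top_iff.2 fun x _ => ?_
  induction x using induction with
  | zero => exact zero_mem _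
  | add x y hx hy => exact add_mem (hx trivial) (hy trivial)
  | of n α =>
    cases n with
    | zero => rw [of_zero_eq_zero h₀]; exact zero_mem _
    | succ n =>
      exact of_mem_of_factors h (Submodule.span (ExtStar N N) (Set.range (of M N 1))).toAddSubgroup n
        (fun a β => Submodule.smul_mem _ (of N N n β) (Submodule.subset_span ⟨a, rfl⟩)) α

/-- A class of degree `n + 2` is a sum of products `γ ∘ b ∘ a` with `a : M → N` and `b : N → M` of
degree one. Since `b ∘ a` lies in `Ext²(M, M)` and `γ` in `Extⁿ(M, N)`, the induction goes in steps
of two and needs both degrees `0` and `1` as base. -/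
lemma of_mem_span_right {M N : C} (h₀ : ∀ f : M ⟶ N, f = 0)
    (h : FactorsThroughExtOne.{w} M N N) (h' : FactorsThroughExtOne.{w} N M N) :
    ∀ (n : ℕ) (α : Ext.{w} M N n),
      of M N n α ∈ Submodule.span (ExtStar M M)ᵐᵒᵖ (Set.range (of M N 1))
  | 0, α => by rw [of_zero_eq_zero h₀]; exact zero_mem _
  | 1, α => Submodule.subset_span ⟨α, rfl⟩
  | n + 2, α => by
    let K := (Submodule.span (ExtStar M M)ᵐᵒᵖ (Set.range (of M N 1))).toAddSubgroup
    refine of_mem_of_factors h K (n + 1) (fun a β => ?_) α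
    -- The second factorization is applied to `β`, inside the subgroup of those `β` with `β ∘ a ∈
    -- K`.
    refine of_mem_of_factors h' (K.comap ((yoneda M N N).flip (of M N 1 a))) n
      (fun b γ => ?_) β
    change yoneda M N N (yoneda N M N (of M N n γ) (of N M 1 b)) (of M N 1 a) ∈ K
    rw [yoneda_assoc]
    exact Submodule.smul_mem _ (MulOpposite.op (yoneda M N M (of N M 1 b) (of M N 1 a)))
      (of_mem_span_right h₀ h h' n γ)

theorem span_right_eq_top {M N : C} (h₀ : ∀ f : M ⟶ N, f = 0)
    (h : FactorsThroughExtOne.{w} M N N) (h' : FactorsThroughExtOne.{w} N M N) :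
    Submodule.span (ExtStar M M)ᵐᵒᵖ (Set.range (of M N 1)) = ⊤ := by
  refine eq_top_iff.2 fun x _ => ?_
  induction x using induction with
  | zero => exact zero_mem _
  | add x y hx hy => exact add_mem (hx trivial) (hy trivial)
  | of n α => exact of_mem_span_right h₀ h h' n α

end ExtStar

/-! ### Dimension shifting along two extensions and a projective. -/

/-- A family of objects `S i` with extensions `U i` and `V i` of `S i` by `S (ν i)` and projective
objects `P i` that are extensions of `U i` by `U (ν i)`, mapping onto `V i` compatibly. -/
structure KoszulFamily (C : Type u) [Category.{v} C] [Abelian C] (I : Type*) where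
  /-- the permutation of the index set -/
  ν : I → I
  /-- the objects under study -/
  S : I → C
  /-- the first extension -/
  U : I → C
  /-- the second extension -/
  V : I → C
  /-- the projective objects -/
  P : I → C
  /-- `S (ν i) ⟶ U i` -/
  ιU (i : I) : S (ν i) ⟶ U i
  /-- `U i ⟶ S i` -/
  πU (i : I) : U i ⟶ S i
  /-- `S (ν i) ⟶ V i` -/
  ιV (i : I) : S (ν i) ⟶ V i
  /-- `V i ⟶ S i` -/
  πV (i : I) : V i ⟶ S i
  /-- `U (ν i) ⟶ P i` -/
  ιP (i : I) : U (ν i) ⟶ P i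
  /-- `P i ⟶ U i` -/
  πP (i : I) : P i ⟶ U i
  /-- `P i ⟶ V i` -/
  q (i : I) : P i ⟶ V i
  wU (i : I) : ιU i ≫ πU i = 0
  wV (i : I) : ιV i ≫ πV i = 0
  wP (i : I) : ιP i ≫ πP i = 0
  exactU (i : I) : (ShortComplex.mk _ _ (wU i)).ShortExact
  exactV (i : I) : (ShortComplex.mk _ _ (wV i)).ShortExact
  exactP (i : I) : (ShortComplex.mk _ _ (wP i)).ShortExact
  comm₁ (i : I) : πU (ν i) ≫ ιV i = ιP i ≫ q i
  comm₂ (i : I) : q i ≫ πV i = πP i ≫ πU i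
  projective (i : I) : Projective (P i)

namespace KoszulFamily

variable {I : Type*} (K : KoszulFamily C I)

/-- The class of the extension `V i`, pulled back to `U i`, is the class of `P i` pushed out along
`U (ν i) ⟶ S (ν i)`. -/
lemma extClass_comp_πU (i : I) :
    (K.exactP i).extClass.comp (Ext.mk₀ (K.πU (K.ν i))) (add_zero 1) =
      (Ext.mk₀ (K.πU i)).comp (K.exactV i).extClass (zero_add 1) :=
  ShortComplex.ShortExact.extClass_naturality (K.exactP i) (K.exactV i)
    { τ₁ := K.πU (K.ν i)
      τ₂ := K.q i
      τ₃ := K.πU i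
      comm₁₂ := K.comm₁ i
      comm₂₃ := K.comm₂ i }

variable {T : C}

/-- Dimension shift: `α` is `δ[P]` with `δ` on `U (ν i)`. If `δ` is pulled back from `ε` on `S (ν
i)`, then `extClass_comp_πU` trades `[P]` for `[V]`, and `α` becomes the pullback of `ε[V]`. -/
lemma πU_comp_extClass_comp_of_lift (i : I) (n : ℕ)
    (hsurj : ∀ δ : Ext.{w} (K.U (K.ν i)) T n, ∃ ε : Ext.{w} (K.S (K.ν i)) T n,
      (Ext.mk₀ (K.πU (K.ν i))).comp ε (zero_add n) = δ)
    (α : Ext.{w} (K.U i) T (n + 1)) : ∃ ε : Ext.{w} (K.S (K.ν i)) T n,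
      (Ext.mk₀ (K.πU i)).comp ((K.exactV i).extClass.comp ε (add_comm 1 n)) (zero_add _) = α := by
  have := K.projective i
  obtain ⟨δ, rfl⟩ := Ext.contravariant_sequence_exact₃ (K.exactP i) T α
    (Ext.eq_zero_of_projective _) (add_comm 1 n)
  obtain ⟨ε, rfl⟩ := hsurj δ
  refine ⟨ε, ?_⟩
  rw [← Ext.comp_assoc _ _ _ (zero_add 1) (add_comm 1 n) (by omega), ← K.extClass_comp_πU i,
    Ext.comp_assoc _ _ _ (add_zero 1) (zero_add n) (by omega)]

/-- In degree zero, `hT` says that maps `U i ⟶ T` factor through the quotient `S i`. Each higher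
degree reduces by the dimension shift to the previous one at the index `ν i`, so the induction runs
over all indices. -/
lemma πU_precomp_surjective (hT : ∀ (i : I) (f : K.U i ⟶ T), K.ιU i ≫ f = 0) (n : ℕ)
    (i : I) (δ : Ext.{w} (K.U i) T n) :
    ∃ ε : Ext.{w} (K.S i) T n, (Ext.mk₀ (K.πU i)).comp ε (zero_add n) = δ := by
  induction n generalizing i with
  | zero =>
    obtain ⟨f, rfl⟩ := (Ext.mk₀_bijective _ _).2 δ
    exact Ext.contravariant_sequence_exact₂ (K.exactU i) T _ (by
      rw [Ext.mk₀_comp_mk₀]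
      simp [hT i f])
  | succ n ih =>
    obtain ⟨ε, hε⟩ := K.πU_comp_extClass_comp_of_lift i n (ih (K.ν i)) δ
    exact ⟨_, hε⟩

theorem factorsThroughExtOne (hT : ∀ (i : I) (f : K.U i ⟶ T), K.ιU i ≫ f = 0) (i : I) :
    FactorsThroughExtOne.{w} (K.S i) (K.S (K.ν i)) T := by
  intro n α
  -- `γ[V]` has the same pullback to `U i` as `α`.
  obtain ⟨γ, hγ⟩ := K.πU_comp_extClass_comp_of_lift i n (K.πU_precomp_surjective hT n (K.ν i))
    ((Ext.mk₀ (K.πU i)).comp α (zero_add _))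
  -- The difference dies on `U i`, so it is a multiple `β[U]` of the connecting class.
  obtain ⟨β, hβ⟩ := Ext.contravariant_sequence_exact₃ (K.exactU i) T
    (α - (K.exactV i).extClass.comp γ (add_comm 1 n))
    (by
      rw [sub_eq_add_neg, Ext.comp_add, Ext.comp_neg]
      exact (congrArg (_ + -·) hγ).trans (add_neg_cancel _)) (add_comm 1 n)
  exact ⟨_, _, β, γ, by rw [hβ, sub_add_cancel]⟩

end KoszulFamily

end Generation

/-! ### The relations of `D(Λ₂)` on its generators. -/

namespace TaftDouble

section

variable (k : Type u) [Field k]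

/-- A generator as an element of `D(Λ₂)`. -/
noncomputable def toGen (s : Gen) : TaftDouble k := RingQuot.mkAlgHom k (Rel k) (gen k s)

lemma toGen_x_sq : toGen k .x * toGen k .x = 0 := by
  simpa [toGen] using RingQuot.mkAlgHom_rel k (Rel.x_sq (k := k))

lemma toGen_X_sq : toGen k .X * toGen k .X = 0 := by
  simpa [toGen] using RingQuot.mkAlgHom_rel k (Rel.X_sq (k := k))

lemma toGen_g_sq : toGen k .g * toGen k .g = 1 := by
  simpa [toGen] using RingQuot.mkAlgHom_rel k (Rel.g_sq (k := k))

lemma toGen_G_sq : toGen k .G * toGen k .G = 1 := by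
  simpa [toGen] using RingQuot.mkAlgHom_rel k (Rel.G_sq (k := k))

lemma toGen_gG : toGen k .g * toGen k .G = toGen k .G * toGen k .g := by
  simpa [toGen] using RingQuot.mkAlgHom_rel k (Rel.gG (k := k))

/-- The sign is kept as a scalar of `k`, so that it moves through products by `mul_smul_comm` and is
absorbed by `module`. -/
lemma toGen_gx : toGen k .g * toGen k .x = (-1 : k) • (toGen k .x * toGen k .g) := by
  have h := RingQuot.mkAlgHom_rel k (Rel.gx (k := k))
  rwa [← neg_one_smul k, map_smul, map_mul, map_mul] at h

lemma toGen_gX : toGen k .g * toGen k .X = (-1 : k) • (toGen k .X * toGen k .g) := by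
  have h := RingQuot.mkAlgHom_rel k (Rel.gX (k := k))
  rwa [← neg_one_smul k, map_smul, map_mul, map_mul] at h

lemma toGen_Gx : toGen k .G * toGen k .x = (-1 : k) • (toGen k .x * toGen k .G) := by
  have h := RingQuot.mkAlgHom_rel k (Rel.Gx (k := k))
  rwa [← neg_one_smul k, map_smul, map_mul, map_mul] at h

lemma toGen_GX : toGen k .G * toGen k .X = (-1 : k) • (toGen k .X * toGen k .G) := by
  have h := RingQuot.mkAlgHom_rel k (Rel.GX (k := k))
  rwa [← neg_one_smul k, map_smul, map_mul, map_mul] at h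

lemma toGen_xX : toGen k .x * toGen k .X + toGen k .X * toGen k .x + toGen k .g * toGen k .G =
    1 := by
  have h := RingQuot.mkAlgHom_rel k (Rel.xX (k := k))
  rw [map_add, map_sub, map_mul, map_mul, map_mul, map_one] at h
  exact eq_sub_iff_add_eq.1 h

variable {k}

@[elab_as_elim]
lemma induction {p : TaftDouble k → Prop} (a : TaftDouble k)
    (algebraMap : ∀ c : k, p (algebraMap k (TaftDouble k) c)) (toGen : ∀ s, p (toGen k s))
    (mul : ∀ a b, p a → p b → p (a * b)) (add : ∀ a b, p a → p b → p (a + b)) : p a := by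
  obtain ⟨a, rfl⟩ := RingQuot.mkAlgHom_surjective k (Rel k) a
  induction a using FreeAlgebra.induction with
  | grade0 r => rw [AlgHom.commutes]; exact algebraMap r
  | grade1 s => exact toGen s
  | mul a b ha hb => rw [map_mul]; exact mul _ _ ha hb
  | add a b ha hb => rw [map_add]; exact add _ _ ha hb

/-! ### Modules as vector spaces with four operators. -/

/-- The additive isomorphism `e` transports the action of `D(Λ₂)` to the vector space structure and
the operators `ρ`. -/
structure ActsBy {M W : Type*} [AddCommGroup M] [Module (TaftDouble k) M] [AddCommGroup W]
    [Module k W] (e : M ≃+ W) (ρ : Gen → Module.End k W) : Prop where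
  algebraMap_smul (c : k) (m : M) : e (algebraMap k (TaftDouble k) c • m) = c • e m
  toGen_smul (s : Gen) (m : M) : e (toGen k s • m) = ρ s (e m)

/-- A linear map that intertwines the operators is `D(Λ₂)`-linear. -/
def ActsBy.hom {M N W W' : Type*} [AddCommGroup M] [AddCommGroup N] [Module (TaftDouble k) M]
    [Module (TaftDouble k) N] [AddCommGroup W] [Module k W] [AddCommGroup W'] [Module k W']
    {e : M ≃+ W} {e' : N ≃+ W'} {ρ : Gen → Module.End k W} {ρ' : Gen → Module.End k W'}
    (h : ActsBy e ρ) (h' : ActsBy e' ρ') (f : W →ₗ[k] W')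
    (hf : ∀ s w, f (ρ s w) = ρ' s (f w)) : M →ₗ[TaftDouble k] N where
  toFun m := e'.symm (f (e m))
  map_add' m n := by simp
  map_smul' a := by
    induction a using TaftDouble.induction with
    | algebraMap c =>
      intro m
      apply e'.injective
      simp [h.algebraMap_smul, h'.algebraMap_smul]
    | toGen s =>
      intro m
      apply e'.injective
      simp [h.toGen_smul, h'.toGen_smul, hf]
    | mul a b ha hb => simp_all [mul_smul]
    | add a b ha hb => simp_all [add_smul]

lemma ActsBy.apply_hom {M N W W' : Type*} [AddCommGroup M] [AddCommGroup N]
    [Module (TaftDouble k) M] [Module (TaftDouble k) N] [AddCommGroup W] [Module k W]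
    [AddCommGroup W'] [Module k W'] {e : M ≃+ W} {e' : N ≃+ W'} {ρ : Gen → Module.End k W}
    {ρ' : Gen → Module.End k W'} (h : ActsBy e ρ) (h' : ActsBy e' ρ') (f : W →ₗ[k] W')
    (hf : ∀ s w, f (ρ s w) = ρ' s (f w)) (m : M) : e' (h.hom h' f hf m) = f (e m) :=
  e'.apply_symm_apply _

/-- `ActsBy.hom` as a morphism of the category of modules. -/
def ActsBy.mor {M N : ModuleCat.{u} (TaftDouble k)} {W W' : Type*} [AddCommGroup W] [Module k W]
    [AddCommGroup W'] [Module k W'] {e : M ≃+ W} {e' : N ≃+ W'} {ρ : Gen → Module.End k W}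
    {ρ' : Gen → Module.End k W'} (h : ActsBy e ρ) (h' : ActsBy e' ρ') (f : W →ₗ[k] W')
    (hf : ∀ s w, f (ρ s w) = ρ' s (f w)) : M ⟶ N :=
  ModuleCat.ofHom (h.hom h' f hf)

lemma ActsBy.apply_mor {M N : ModuleCat.{u} (TaftDouble k)} {W W' : Type*} [AddCommGroup W]
    [Module k W] [AddCommGroup W'] [Module k W'] {e : M ≃+ W} {e' : N ≃+ W'}
    {ρ : Gen → Module.End k W} {ρ' : Gen → Module.End k W'} (h : ActsBy e ρ) (h' : ActsBy e' ρ')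
    (f : W →ₗ[k] W') (hf : ∀ s w, f (ρ s w) = ρ' s (f w)) (m : M) :
    e' ((h.mor h' f hf).hom m) = f (e m) :=
  h.apply_hom h' f hf m

/-- The `D(Λ₂)`-module given by a vector space with four operators that satisfy the relations. -/
noncomputable def ofOperators {W : Type u} [AddCommGroup W] [Module k W]
    (ρ : Gen → Module.End k W)
    (h : ∀ ⦃a b⦄, Rel k a b → FreeAlgebra.lift k ρ a = FreeAlgebra.lift k ρ b) :
    ModuleCat.{u} (TaftDouble k) :=
  (ModuleCat.restrictScalars
    (RingQuot.liftAlgHom k ⟨FreeAlgebra.lift k ρ, h⟩ : TaftDouble k →ₐ[k] _).toRingHom).obj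
    (ModuleCat.of (Module.End k W) W)

section ofOperators

variable {W : Type u} [AddCommGroup W] [Module k W] (ρ : Gen → Module.End k W)
    (h : ∀ ⦃a b⦄, Rel k a b → FreeAlgebra.lift k ρ a = FreeAlgebra.lift k ρ b)

/-- The identification of `ofOperators ρ h` with the vector space it is built on. -/
noncomputable def opEquiv : ofOperators ρ h ≃+ W := AddEquiv.refl W

lemma opEquiv_smul (a : TaftDouble k) (m : ofOperators ρ h) :
    opEquiv ρ h (a • m) =
      (RingQuot.liftAlgHom k ⟨FreeAlgebra.lift k ρ, h⟩ : TaftDouble k →ₐ[k] _) a (opEquiv ρ h m) :=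
  rfl

lemma actsBy_ofOperators : ActsBy (opEquiv ρ h) ρ where
  algebraMap_smul c m := by
    rw [opEquiv_smul, AlgHom.commutes, Module.algebraMap_end_apply]
  toGen_smul s m := by
    rw [opEquiv_smul, toGen, RingQuot.liftAlgHom_mkAlgHom_apply, FreeAlgebra.lift_ι_apply]

end ofOperators

/-! ### The simple modules, their extensions and the projective covers. -/

/-- The one-dimensional module on which `g` and `G` act as the square root of unity `ε`. -/
noncomputable def sgn (ε : {ε : k // ε * ε = 1}) : ModuleCat.{u} (TaftDouble k) :=
  (ModuleCat.restrictScalars (character k ε.1 ε.2).toRingHom).obj (ModuleCat.of k k)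

/-- The identification of `sgn ε` with `k`. -/
noncomputable def sgnEquiv (ε : {ε : k // ε * ε = 1}) : sgn ε ≃+ k := AddEquiv.refl k

/-- The operators of the generators on `sgn ε`. -/
def sgnOp (ε : k) : Gen → Module.End k k
  | .x => 0
  | .X => 0
  | .g => ε • LinearMap.id
  | .G => ε • LinearMap.id

lemma sgnEquiv_smul (ε : {ε : k // ε * ε = 1}) (a : TaftDouble k) (m : sgn ε) :
    sgnEquiv ε (a • m) = character k ε.1 ε.2 a * sgnEquiv ε m := rfl

lemma actsBy_sgn (ε : {ε : k // ε * ε = 1}) : ActsBy (sgnEquiv ε) (sgnOp ε.1) where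
  algebraMap_smul c m := by
    rw [sgnEquiv_smul, AlgHom.commutes, Algebra.algebraMap_self_apply, smul_eq_mul]
  toGen_smul s m := by
    rw [sgnEquiv_smul, toGen, character, RingQuot.liftAlgHom_mkAlgHom_apply,
      FreeAlgebra.lift_ι_apply]
    cases s <;> simp [sgnOp]

/-- The operator `(a, b) ↦ (p a, n a + q b)`. -/
def lowerTriangular (p n q : k) : Module.End k (k × k) where
  toFun w := (p * w.1, n * w.1 + q * w.2)
  map_add' _ _ := by ext <;> simp <;> ring
  map_smul' _ _ := by ext <;> simp <;> ring

@[simp]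
lemma lowerTriangular_apply (p n q : k) (w : k × k) :
    lowerTriangular p n q w = (p * w.1, n * w.1 + q * w.2) := rfl

/-- The operators of the generators on the two-dimensional module with a top vector of weight `ε`
that `x` and `X` multiply by `s` and `t` times the bottom vector. -/
def planeOp (ε s t : k) : Gen → Module.End k (k × k)
  | .x => lowerTriangular 0 s 0
  | .X => lowerTriangular 0 t 0
  | .g => lowerTriangular ε 0 (-ε)
  | .G => lowerTriangular ε 0 (-ε)

/-- `x` and `X` act by strictly triangular operators, whose products vanish; `g` and `G` act by the
same involution, so `1 - gG` acts as zero too. -/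
lemma planeOp_rel {ε : k} (hε : ε * ε = 1) (s t : k) ⦃a b : Free k⦄ (h : Rel k a b) :
    FreeAlgebra.lift k (planeOp ε s t) a = FreeAlgebra.lift k (planeOp ε s t) b := by
  cases h <;> ext <;> simp [planeOp, hε, mul_comm]

/-- The two-dimensional extension of `sgn ε` by `sgn (-ε)` with parameters `s` and `t`. -/
noncomputable def plane (ε : {ε : k // ε * ε = 1}) (s t : k) : ModuleCat.{u} (TaftDouble k) :=
  ofOperators (planeOp ε.1 s t) (planeOp_rel ε.2 s t)

/-- The identification of `plane ε s t` with `k × k`. -/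
noncomputable def planeEquiv (ε : {ε : k // ε * ε = 1}) (s t : k) : plane ε s t ≃+ k × k :=
  opEquiv _ _

lemma actsBy_plane (ε : {ε : k // ε * ε = 1}) (s t : k) :
    ActsBy (planeEquiv ε s t) (planeOp ε.1 s t) :=
  actsBy_ofOperators _ _

/-- The operators of the generators on the projective cover of `sgn ε`, in the basis
`v, x v, X v, x X v`. -/
def coverOp (ε : k) : Gen → Module.End k ((k × k) × (k × k))
  | .x => (lowerTriangular 0 1 0).prodMap (lowerTriangular 0 1 0)
  | .X => LinearMap.inr k _ _ ∘ₗ lowerTriangular 1 0 (-1) ∘ₗ LinearMap.fst k _ _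
  | .g => (lowerTriangular ε 0 (-ε)).prodMap (lowerTriangular (-ε) 0 ε)
  | .G => (lowerTriangular ε 0 (-ε)).prodMap (lowerTriangular (-ε) 0 ε)

/-- `g` and `G` act by the same involution, so the last relation asks `x` and `X` to anticommute;
this is the entry `-1` in the operator of `X`. -/
lemma coverOp_rel {ε : k} (hε : ε * ε = 1) ⦃a b : Free k⦄ (h : Rel k a b) :
    FreeAlgebra.lift k (coverOp ε) a = FreeAlgebra.lift k (coverOp ε) b := by
  cases h <;> refine LinearMap.ext fun w => ?_ <;>
    simp [coverOp, Prod.ext_iff, ← mul_assoc, hε, mul_comm]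

/-- The four-dimensional projective cover of `sgn ε`. -/
noncomputable def cover (ε : {ε : k // ε * ε = 1}) : ModuleCat.{u} (TaftDouble k) :=
  ofOperators (coverOp ε.1) (coverOp_rel ε.2)

/-- The identification of `cover ε` with `(k × k) × (k × k)`. -/
noncomputable def coverEquiv (ε : {ε : k // ε * ε = 1}) : cover ε ≃+ (k × k) × (k × k) :=
  opEquiv _ _

lemma actsBy_cover (ε : {ε : k // ε * ε = 1}) : ActsBy (coverEquiv ε) (coverOp ε.1) :=
  actsBy_ofOperators _ _

/-- The inclusion of the bottom vector. -/
noncomputable def planeι (ε ε' : {ε : k // ε * ε = 1}) (h : ε'.1 = -ε.1) (s t : k) :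
    sgn ε' ⟶ plane ε s t :=
  (actsBy_sgn ε').mor (actsBy_plane ε s t) (LinearMap.inr k k k)
    (fun r m => by cases r <;> simp [planeOp, sgnOp, h])

/-- The projection onto the top vector. -/
noncomputable def planeπ (ε : {ε : k // ε * ε = 1}) (s t : k) :
    plane ε s t ⟶ sgn ε :=
  (actsBy_plane ε s t).mor (actsBy_sgn ε) (LinearMap.fst k k k)
    (fun r m => by cases r <;> simp [planeOp, sgnOp])

/-- The inclusion of the submodule generated by `X v` in the projective cover. -/
noncomputable def coverι (ε ε' : {ε : k // ε * ε = 1}) (h : ε'.1 = -ε.1) :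
    plane ε' 1 0 ⟶ cover ε :=
  (actsBy_plane ε' 1 0).mor (actsBy_cover ε) (LinearMap.inr k (k × k) (k × k))
    (fun r m => by cases r <;> simp [coverOp, planeOp, h, Prod.ext_iff])

/-- The quotient of the projective cover by the submodule generated by `X v`. -/
noncomputable def coverπ (ε : {ε : k // ε * ε = 1}) :
    cover ε ⟶ plane ε 1 0 :=
  (actsBy_cover ε).mor (actsBy_plane ε 1 0) (LinearMap.fst k (k × k) (k × k))
    (fun r m => by cases r <;> simp [coverOp, planeOp, Prod.ext_iff])

/-- The quotient of the projective cover by the submodule generated by `x v`. -/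
noncomputable def coverQ (ε : {ε : k // ε * ε = 1}) :
    cover ε ⟶ plane ε 0 1 :=
  (actsBy_cover ε).mor (actsBy_plane ε 0 1) ((LinearMap.fst k k k).prodMap (LinearMap.fst k k k))
    (fun r m => by cases r <;> simp [coverOp, planeOp])

/-! ### Projectivity of the cover. -/

/-- The idempotent of weight `ε`. -/
noncomputable def idem (ε : k) : TaftDouble k :=
  (4⁻¹ : k) • ((1 + ε • toGen k .g) * (1 + ε • toGen k .G))

lemma toGen_g_mul_idem {ε : k} (hε : ε * ε = 1) : toGen k .g * idem ε = ε • idem ε := by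
  have h : toGen k .g * (1 + ε • toGen k .g) = ε • (1 + ε • toGen k .g) := by
    rw [mul_add, mul_one, mul_smul_comm, toGen_g_sq, smul_add, smul_smul, hε, one_smul, add_comm]
  rw [idem, mul_smul_comm, ← mul_assoc, h, smul_mul_assoc, smul_comm]

lemma toGen_G_mul_idem {ε : k} (hε : ε * ε = 1) : toGen k .G * idem ε = ε • idem ε := by
  have h : toGen k .G * (1 + ε • toGen k .G) = ε • (1 + ε • toGen k .G) := by
    rw [mul_add, mul_one, mul_smul_comm, toGen_G_sq, smul_add, smul_smul, hε, one_smul, add_comm]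
  have h' : toGen k .G * (1 + ε • toGen k .g) = (1 + ε • toGen k .g) * toGen k .G := by
    rw [mul_add, add_mul, mul_smul_comm, smul_mul_assoc, toGen_gG, mul_one, one_mul]
  rw [idem, mul_smul_comm, ← mul_assoc, h', mul_assoc, h, mul_smul_comm, smul_comm]

/-- The map from the projective cover to `D(Λ₂)` that sends the top vector to `idem ε`. -/
noncomputable def coverSectionFun (ε : k) : ((k × k) × (k × k)) →ₗ[k] TaftDouble k :=
  LinearMap.coprod
    (LinearMap.coprod (LinearMap.toSpanSingleton k _ (idem ε))
      (LinearMap.toSpanSingleton k _ (toGen k .x * idem ε)))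
    (LinearMap.coprod (LinearMap.toSpanSingleton k _ (toGen k .X * idem ε))
      (LinearMap.toSpanSingleton k _ (toGen k .x * (toGen k .X * idem ε))))

lemma coverSectionFun_apply (ε : k) (w : (k × k) × (k × k)) :
    coverSectionFun ε w = w.1.1 • idem ε + w.1.2 • (toGen k .x * idem ε) +
      (w.2.1 • (toGen k .X * idem ε) + w.2.2 • (toGen k .x * (toGen k .X * idem ε))) := by
  simp [coverSectionFun]

lemma toGen_gG_mul_idem {ε : k} (hε : ε * ε = 1) :
    toGen k .g * (toGen k .G * idem ε) = idem ε := by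
  rw [toGen_G_mul_idem hε, mul_smul_comm, toGen_g_mul_idem hε, smul_smul, hε, one_smul]

/-- `gG` fixes `idem ε`, so `xX + Xx = 1 - gG` kills it. -/
lemma toGen_X_mul_x_mul_idem {ε : k} (hε : ε * ε = 1) :
    toGen k .X * (toGen k .x * idem ε) = (-1 : k) • (toGen k .x * (toGen k .X * idem ε)) := by
  have h := congrArg (· * idem ε) (toGen_xX k)
  simp only [add_mul, mul_assoc, toGen_gG_mul_idem hε, one_mul] at h
  exact (eq_neg_of_add_eq_zero_right (add_eq_right.1 h)).trans (neg_one_smul k _).symm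

lemma coverSectionFun_coverOp {ε : k} (hε : ε * ε = 1) (s : Gen) (w : (k × k) × (k × k)) :
    coverSectionFun ε (coverOp ε s w) = toGen k s * coverSectionFun ε w := by
  have hxx (a : TaftDouble k) : toGen k .x * (toGen k .x * a) = 0 := by
    rw [← mul_assoc, toGen_x_sq, zero_mul]
  have hXX (a : TaftDouble k) : toGen k .X * (toGen k .X * a) = 0 := by
    rw [← mul_assoc, toGen_X_sq, zero_mul]
  have hgx (a : TaftDouble k) :
      toGen k .g * (toGen k .x * a) = (-1 : k) • (toGen k .x * (toGen k .g * a)) := by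
    rw [← mul_assoc, toGen_gx, smul_mul_assoc, mul_assoc]
  have hgX (a : TaftDouble k) :
      toGen k .g * (toGen k .X * a) = (-1 : k) • (toGen k .X * (toGen k .g * a)) := by
    rw [← mul_assoc, toGen_gX, smul_mul_assoc, mul_assoc]
  have hGx (a : TaftDouble k) :
      toGen k .G * (toGen k .x * a) = (-1 : k) • (toGen k .x * (toGen k .G * a)) := by
    rw [← mul_assoc, toGen_Gx, smul_mul_assoc, mul_assoc]
  have hGX (a : TaftDouble k) :
      toGen k .G * (toGen k .X * a) = (-1 : k) • (toGen k .X * (toGen k .G * a)) := by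
    rw [← mul_assoc, toGen_GX, smul_mul_assoc, mul_assoc]
  have hXx := toGen_X_mul_x_mul_idem hε
  -- Multiply the anticommutation on `idem ε` by `X` and use `X² = 0`.
  have hXxX : toGen k .X * (toGen k .x * (toGen k .X * idem ε)) = 0 := by
    have h := congrArg (toGen k .X * ·) hXx
    simp only [hXX, mul_smul_comm] at h
    exact (smul_eq_zero_iff_right (neg_ne_zero.2 one_ne_zero)).1 h.symm
  simp only [coverSectionFun_apply, mul_add, mul_smul_comm]
  cases s
  · simp only [coverOp, LinearMap.prodMap_apply, lowerTriangular_apply, hxx]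
    module
  · simp only [coverOp, LinearMap.comp_apply, LinearMap.inr_apply, LinearMap.fst_apply,
      lowerTriangular_apply, hXX, hXx, hXxX, Prod.fst_zero, Prod.snd_zero]
    module
  · simp only [coverOp, LinearMap.prodMap_apply, lowerTriangular_apply, hgx, hgX,
      toGen_g_mul_idem hε, mul_smul_comm]
    module
  · simp only [coverOp, LinearMap.prodMap_apply, lowerTriangular_apply, hGx, hGX,
      toGen_G_mul_idem hε, mul_smul_comm]
    module

/-- With this, linearity of the map from the cover to the regular module is checked on generators
only. -/
lemma actsBy_self :
    ActsBy (AddEquiv.refl (TaftDouble k)) (fun s => LinearMap.mulLeft k (toGen k s)) where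
  algebraMap_smul c m := (Algebra.smul_def c m).symm
  toGen_smul _ _ := rfl

/-- The embedding of the projective cover into `D(Λ₂)`. -/
noncomputable def coverSection (ε : {ε : k // ε * ε = 1}) : cover ε →ₗ[TaftDouble k] TaftDouble k :=
  (actsBy_cover ε).hom actsBy_self (coverSectionFun ε.1) (coverSectionFun_coverOp ε.2)

/-- The top vector of the projective cover. -/
noncomputable def coverTop (ε : {ε : k // ε * ε = 1}) : cover ε := (coverEquiv ε).symm ((1, 0), 0)

lemma ActsBy.smul_smul {M W : Type*} [AddCommGroup M] [Module (TaftDouble k) M] [AddCommGroup W]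
    [Module k W] {e : M ≃+ W} {ρ : Gen → Module.End k W} (h : ActsBy e ρ) (c : k)
    (a : TaftDouble k) (m : M) : e ((c • a) • m) = c • e (a • m) := by
  rw [Algebra.smul_def, mul_smul, h.algebraMap_smul]

/-- Each of `1 + εg` and `1 + εG` multiplies the top vector by `1 + ε² = 2`; the factor `4⁻¹`
cancels this when `2 ≠ 0`. -/
lemma idem_smul_coverTop (h2 : (2 : k) ≠ 0) (ε : {ε : k // ε * ε = 1}) :
    idem ε.1 • coverTop ε = coverTop ε := by
  have h := actsBy_cover ε
  have h4 : (4 : k)⁻¹ * (2 * 2) = 1 := by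
    rw [show (2 * 2 : k) = 4 by norm_num]
    exact inv_mul_cancel₀ (by rw [show (4 : k) = 2 * 2 by norm_num]; exact mul_ne_zero h2 h2)
  apply (coverEquiv ε).injective
  simp [idem, h.smul_smul, mul_smul, add_smul, h.toGen_smul, coverTop, coverOp, Prod.ext_iff, ε.2]
  linear_combination h4

lemma coverSectionFun_smul_coverTop (h2 : (2 : k) ≠ 0) (ε : {ε : k // ε * ε = 1})
    (w : (k × k) × (k × k)) :
    coverEquiv ε (coverSectionFun ε.1 w • coverTop ε) = w := by
  obtain ⟨⟨a, b⟩, c, d⟩ := w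
  have h := actsBy_cover ε
  rw [coverSectionFun_apply]
  simp only [add_smul, map_add, h.smul_smul, mul_smul, h.toGen_smul, idem_smul_coverTop h2]
  simp [coverTop, coverOp]

/-- The cover is a direct summand of the regular module: `coverSection` is split by `a ↦ a • v`,
with `v` the top vector. -/
theorem projective_cover (h2 : (2 : k) ≠ 0) (ε : {ε : k // ε * ε = 1}) : Projective (cover ε) := by
  have : Module.Projective (TaftDouble k) (cover ε) :=
    Module.Projective.of_split (coverSection ε) (LinearMap.toSpanSingleton _ _ (coverTop ε)) (by
      ext m
      apply (coverEquiv ε).injective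
      exact coverSectionFun_smul_coverTop h2 ε (coverEquiv ε m))
  exact (IsProjective.iff_projective (cover ε)).1 this

/-! ### Assembling the family and applying it to the simple modules. -/

/-- The involution `ε ↦ -ε` on the square roots of unity. -/
def negRoot (ε : {ε : k // ε * ε = 1}) : {ε : k // ε * ε = 1} := ⟨-ε.1, by simpa using ε.2⟩

/-- Short exactness can be checked on the underlying vector spaces. -/
theorem ActsBy.shortExact {M₁ M₂ M₃ : ModuleCat.{u} (TaftDouble k)} {W₁ W₂ W₃ : Type u}
    [AddCommGroup W₁] [Module k W₁] [AddCommGroup W₂] [Module k W₂] [AddCommGroup W₃] [Module k W₃]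
    {e₁ : M₁ ≃+ W₁} {e₂ : M₂ ≃+ W₂} {e₃ : M₃ ≃+ W₃} {ρ₁ : Gen → Module.End k W₁}
    {ρ₂ : Gen → Module.End k W₂} {ρ₃ : Gen → Module.End k W₃} (h₁ : ActsBy e₁ ρ₁)
    (h₂ : ActsBy e₂ ρ₂) (h₃ : ActsBy e₃ ρ₃) {f : W₁ →ₗ[k] W₂} {g : W₂ →ₗ[k] W₃}
    (hf : ∀ s w, f (ρ₁ s w) = ρ₂ s (f w)) (hg : ∀ s w, g (ρ₂ s w) = ρ₃ s (g w))
    (hfg : Function.Exact f g) (f_inj : Function.Injective f) (g_surj : Function.Surjective g)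
    (w : h₁.mor h₂ f hf ≫ h₂.mor h₃ g hg = 0) :
    (ShortComplex.mk _ _ w).ShortExact := by
  refine ModuleCat.shortComplex_shortExact _ (fun m => ?_)
    (e₂.symm.injective.comp (f_inj.comp e₁.injective))
    (e₃.symm.surjective.comp (g_surj.comp e₂.surjective))
  change e₃.symm (g (e₂ m)) = 0 ↔ ∃ n, e₂.symm (f (e₁ n)) = m
  rw [map_eq_zero_iff _ e₃.symm.injective, hfg (e₂ m)]
  exact ⟨fun ⟨n, hn⟩ => ⟨e₁.symm n, by simp [hn]⟩, fun ⟨n, hn⟩ => ⟨e₁ n, by simp [← hn]⟩⟩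

lemma ActsBy.hom_comp_hom_eq_zero {M₁ M₂ M₃ : ModuleCat.{u} (TaftDouble k)} {W₁ W₂ W₃ : Type u}
    [AddCommGroup W₁] [Module k W₁] [AddCommGroup W₂] [Module k W₂] [AddCommGroup W₃] [Module k W₃]
    {e₁ : M₁ ≃+ W₁} {e₂ : M₂ ≃+ W₂} {e₃ : M₃ ≃+ W₃} {ρ₁ : Gen → Module.End k W₁}
    {ρ₂ : Gen → Module.End k W₂} {ρ₃ : Gen → Module.End k W₃} (h₁ : ActsBy e₁ ρ₁)
    (h₂ : ActsBy e₂ ρ₂) (h₃ : ActsBy e₃ ρ₃) {f : W₁ →ₗ[k] W₂} {g : W₂ →ₗ[k] W₃}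
    (hf : ∀ s w, f (ρ₁ s w) = ρ₂ s (f w)) (hg : ∀ s w, g (ρ₂ s w) = ρ₃ s (g w))
    (hfg : Function.Exact f g) :
    h₁.mor h₂ f hf ≫ h₂.mor h₃ g hg = 0 := by
  ext m
  apply e₃.injective
  change e₃ ((h₂.mor h₃ g hg).hom ((h₁.mor h₂ f hf).hom m)) = e₃ 0
  rw [apply_mor, apply_mor, hfg.apply_apply_eq_zero, map_zero]

lemma exact_inr_fst (V W : Type u) [AddCommGroup V] [Module k V] [AddCommGroup W] [Module k W] :
    Function.Exact (LinearMap.inr k V W) (LinearMap.fst k V W) := by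
  rintro ⟨v, w⟩
  simp [eq_comm]

/-- The modules `sgn ε`, the non-split extensions between them and their projective covers. -/
noncomputable def koszulFamily (h2 : (2 : k) ≠ 0) :
    KoszulFamily (ModuleCat.{u} (TaftDouble k)) {ε : k // ε * ε = 1} where
  ν := negRoot
  S := sgn
  U ε := plane ε 1 0
  V ε := plane ε 0 1
  P := cover
  ιU ε := planeι ε (negRoot ε) rfl 1 0
  πU ε := planeπ ε 1 0
  ιV ε := planeι ε (negRoot ε) rfl 0 1
  πV ε := planeπ ε 0 1
  ιP ε := coverι ε (negRoot ε) rfl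
  πP ε := coverπ ε
  q ε := coverQ ε
  wU ε := ActsBy.hom_comp_hom_eq_zero _ _ _ _ _ (exact_inr_fst k k)
  wV ε := ActsBy.hom_comp_hom_eq_zero _ _ _ _ _ (exact_inr_fst k k)
  wP ε := ActsBy.hom_comp_hom_eq_zero _ _ _ _ _ (exact_inr_fst (k × k) (k × k))
  exactU ε := ActsBy.shortExact _ _ _ _ _ (exact_inr_fst k k) LinearMap.inr_injective
    LinearMap.fst_surjective _
  exactV ε := ActsBy.shortExact _ _ _ _ _ (exact_inr_fst k k) LinearMap.inr_injective
    LinearMap.fst_surjective _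
  exactP ε := ActsBy.shortExact _ _ _ _ _ (exact_inr_fst (k × k) (k × k)) LinearMap.inr_injective
    LinearMap.fst_surjective _
  -- Both composites send the vector `Xv` to the bottom of the plane and kill `xXv`.
  comm₁ ε := by
    ext m
    apply (planeEquiv ε 0 1).injective
    change planeEquiv ε 0 1 ((planeι ε (negRoot ε) rfl 0 1).hom ((planeπ _ 1 0).hom m)) =
      planeEquiv ε 0 1 ((coverQ ε).hom ((coverι ε (negRoot ε) rfl).hom m))
    simp only [planeι, planeπ, coverQ, coverι, ActsBy.apply_mor]
    rfl
  -- Both composites read off the coefficient of `v`.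
  comm₂ ε := by
    ext m
    apply (sgnEquiv ε).injective
    change sgnEquiv ε ((planeπ ε 0 1).hom ((coverQ ε).hom m)) =
      sgnEquiv ε ((planeπ ε 1 0).hom ((coverπ ε).hom m))
    simp only [planeπ, coverQ, coverπ, ActsBy.apply_mor]
    rfl
  projective := projective_cover h2

/-- The bottom vector is `x` times the top one, and `x` acts as zero on `sgn δ`. This is the
degree-zero input to the dimension shift. -/
lemma planeι_comp_eq_zero (ε ε' δ : {ε : k // ε * ε = 1}) (h : ε'.1 = -ε.1)
    (f : plane ε 1 0 ⟶ sgn δ) : planeι ε ε' h 1 0 ≫ f = 0 := by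
  ext m
  have hm : (planeι ε ε' h 1 0).hom m =
      toGen k .x • (planeEquiv ε 1 0).symm (sgnEquiv ε' m, 0) := by
    apply (planeEquiv ε 1 0).injective
    rw [planeι, ActsBy.apply_mor, (actsBy_plane ε 1 0).toGen_smul]
    simp [planeOp]
  apply (sgnEquiv δ).injective
  change sgnEquiv δ (f.hom ((planeι ε ε' h 1 0).hom m)) = sgnEquiv δ 0
  rw [hm, map_smul, (actsBy_sgn δ).toGen_smul]
  simp [sgnOp]

/-- `g` acts on source and target by different scalars. -/
lemma hom_sgn_eq_zero {ε δ : {ε : k // ε * ε = 1}} (h : ε.1 ≠ δ.1) (f : sgn ε ⟶ sgn δ) : f = 0 := by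
  ext m
  have hg : toGen k .g • m = algebraMap k (TaftDouble k) ε.1 • m := by
    apply (sgnEquiv ε).injective
    rw [(actsBy_sgn ε).toGen_smul, (actsBy_sgn ε).algebraMap_smul]
    rfl
  have hf := congrArg f.hom hg
  rw [map_smul, map_smul] at hf
  replace hf := congrArg (sgnEquiv δ) hf
  rw [(actsBy_sgn δ).toGen_smul, (actsBy_sgn δ).algebraMap_smul] at hf
  change δ.1 * sgnEquiv δ (f.hom m) = ε.1 * sgnEquiv δ (f.hom m) at hf
  apply (sgnEquiv δ).injective
  change sgnEquiv δ (f.hom m) = sgnEquiv δ 0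
  rw [map_zero]
  by_contra hne
  exact h (mul_right_cancel₀ hne hf).symm

theorem factorsThroughExtOne_sgn (h2 : (2 : k) ≠ 0) {ε ε' : {ε : k // ε * ε = 1}}
    (h : ε'.1 = -ε.1) (δ : {ε : k // ε * ε = 1}) :
    FactorsThroughExtOne.{u} (sgn ε) (sgn ε') (sgn δ) := by
  obtain rfl : ε' = negRoot ε := Subtype.ext h
  exact (koszulFamily h2).factorsThroughExtOne (T := sgn δ)
    (fun i f => planeι_comp_eq_zero i (negRoot i) δ rfl f) ε

end
end TaftDouble

theorem mainTheorem6 (k : Type u) [Field k] [IsAlgClosed k] (hk : ringChar k ≠ 2) :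
    (Submodule.span (ExtStar (TaftDouble.kMinus k) (TaftDouble.kMinus k))
        (Set.range (ExtStar.of (TaftDouble.triv k) (TaftDouble.kMinus k) 1)) = ⊤ ∧
      Submodule.span (ExtStar (TaftDouble.triv k) (TaftDouble.triv k))ᵐᵒᵖ
        (Set.range (ExtStar.of (TaftDouble.triv k) (TaftDouble.kMinus k) 1)) = ⊤) ∧
    (Submodule.span (ExtStar (TaftDouble.triv k) (TaftDouble.triv k))
        (Set.range (ExtStar.of (TaftDouble.kMinus k) (TaftDouble.triv k) 1)) = ⊤ ∧
      Submodule.span (ExtStar (TaftDouble.kMinus k) (TaftDouble.kMinus k))ᵐᵒᵖ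
        (Set.range (ExtStar.of (TaftDouble.kMinus k) (TaftDouble.triv k) 1)) = ⊤) := by
  have h2 : (2 : k) ≠ 0 := Ring.two_ne_zero hk
  have hne : (1 : k) ≠ -1 := fun h => h2 (by linear_combination h)
  -- `triv k` and `kMinus k` are `sgn p` and `sgn m` by definition, so the results on `sgn` apply to
  -- them directly.
  let p : {ε : k // ε * ε = 1} := ⟨1, by simp⟩
  let m : {ε : k // ε * ε = 1} := ⟨-1, by simp⟩
  have hpm : m.1 = -p.1 := rfl
  have hmp : p.1 = -m.1 := (neg_neg 1).symm
  have h₀ (f : TaftDouble.triv k ⟶ TaftDouble.kMinus k) : f = 0 :=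
    TaftDouble.hom_sgn_eq_zero (ε := p) (δ := m) hne f
  have h₀' (f : TaftDouble.kMinus k ⟶ TaftDouble.triv k) : f = 0 :=
    TaftDouble.hom_sgn_eq_zero (ε := m) (δ := p) hne.symm f
  have h₁ : FactorsThroughExtOne.{u} (TaftDouble.triv k) (TaftDouble.kMinus k)
      (TaftDouble.kMinus k) := TaftDouble.factorsThroughExtOne_sgn h2 hpm m
  have h₂ : FactorsThroughExtOne.{u} (TaftDouble.triv k) (TaftDouble.kMinus k)
      (TaftDouble.triv k) := TaftDouble.factorsThroughExtOne_sgn h2 hpm p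
  have h₃ : FactorsThroughExtOne.{u} (TaftDouble.kMinus k) (TaftDouble.triv k)
      (TaftDouble.kMinus k) := TaftDouble.factorsThroughExtOne_sgn h2 hmp m
  have h₄ : FactorsThroughExtOne.{u} (TaftDouble.kMinus k) (TaftDouble.triv k)
      (TaftDouble.triv k) := TaftDouble.factorsThroughExtOne_sgn h2 hmp p
  exact ⟨⟨ExtStar.span_left_eq_top h₀ h₁, ExtStar.span_right_eq_top h₀ h₁ h₃⟩,
    ExtStar.span_left_eq_top h₀' h₄, ExtStar.span_right_eq_top h₀' h₄ h₂⟩
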